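/- All graphs are finite, simple and undirected. A graph is outerplanar if it has a crossing-free drawing in the plane with all vertices on the outer face (equivalently, with its vertices at distinct points of a circle and its edges drawn as chords no two of which cross). For a graph $G=(V,E)$ and an integer $D\ge 0$, a diameter-$D$ outerplanar completion of $G$ is an outerplanar graph $H=(V,E\cup F)$ obtained from $G$ by adding a (possibly empty) set $F$ of edges, such that $H$ has diameter at most $D$. For $u\in V$ let $\mathrm{ecc}(u,H)=\max_{w\in V}\mathrm{dist}_H(u,w)$ and let $$\mathrm{ecc}^*(u,G)=\min_H \mathrm{ecc}(u,H),$$ the minimum being over all diameter-$D$ outerplanar completions $H$ of $G$, with $\mathrm{ecc}^*(u,G)=\infty$ if there are none. Let $G$ be a connected outerplanar graph with a cut vertex $v$, and let $C_1,\dots,C_t$ be the vertex sets of the connected components of $G-v$. The sets $B_i=C_i\cup\{v\}$ are the branches of $G$ at $v$; for a vertex set $B\ni v$ write $\mathrm{ecc}^*(v,B)$ for $\mathrm{ecc}^*(v,G[B])$. Lemma. Suppose that $t\ge 7$ and that the branches are numbered so that $\mathrm{ecc}^*(v,B_1)\ge \mathrm{ecc}^*(v,B_2)\ge\dots\ge \mathrm{ecc}^*(v,B_t)$.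 Then $G$ has a diameter-$D$ outerplanar completion if and only if $$\mathrm{ecc}^*(v,B_1\cup\dots\cup B_6)+\mathrm{ecc}^*(v,B_7)\le D.$$ -/

import Mathlib

namespace SimpleGraph

/-- A (finite) graph is outerplanar if it can be drawn in the plane without crossings and with
all vertices on the outer face: the vertices are placed at distinct points of the unit circle
and the edges are drawn as chords of the disc, two different edges meeting at most in a common
end. (The relative interior of a chord never contains a point of the circle, so an edge passes
through no vertex other than its ends.) -/
def IsOuterplanar {V : Type*} (G : SimpleGraph V) : Prop :=
  ∃ p : V → Circle, Function.Injective p ∧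
    ∀ a b c d : V, G.Adj a b → G.Adj c d → s(a, b) ≠ s(c, d) →
      Disjoint (openSegment ℝ (p a : ℂ) (p b : ℂ)) (openSegment ℝ (p c : ℂ) (p d : ℂ))

/-- `H` is a diameter-`D` outerplanar completion of `G`: it is obtained from `G` by adding edges
on the same vertex set, it is outerplanar, and its diameter is at most `D` (the extended diameter
`ediam` of a disconnected graph is `⊤`, so `H` is connected). -/
def IsOuterplanarCompletion {V : Type*} (D : ℕ) (G H : SimpleGraph V) : Prop :=
  G ≤ H ∧ H.IsOuterplanar ∧ H.ediam ≤ D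

/-- `ecc*_D(u, G)`: the minimum eccentricity of `u` over all diameter-`D` outerplanar completions
of `G`, and `⊤` if there are none. -/
noncomputable def eccStar {V : Type*} (D : ℕ) (G : SimpleGraph V) (u : V) : ℕ∞ :=
  ⨅ (H : SimpleGraph V) (_ : IsOuterplanarCompletion D G H), H.eccent u

/-- `ecc*_D(u, G[S])` for a vertex set `S` containing `u`. -/
noncomputable def eccStarOn {V : Type*} (D : ℕ) (G : SimpleGraph V) (S : Set V) (u : V)
    (hu : u ∈ S) : ℕ∞ :=
  eccStar D (G.induce S) ⟨u, hu⟩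

/-- The branch of `G` at `v` given by a connected component `C` of `G - v`: the vertex set of `C`
together with `v`. -/
def branch {V : Type*} (G : SimpleGraph V) (v : V)
    (C : (G.induce ({v}ᶜ : Set V)).ConnectedComponent) : Set V :=
  insert v (Subtype.val '' C.supp)

theorem mem_branch {V : Type*} (G : SimpleGraph V) (v : V)
    (C : (G.induce ({v}ᶜ : Set V)).ConnectedComponent) : v ∈ G.branch v C :=
  Set.mem_insert _ _

/-- `v` is a cut vertex of the connected graph `G`: deleting it leaves at least two components. -/
def IsCutVertex {V : Type*} (G : SimpleGraph V) (v : V) : Prop :=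
  Nontrivial (G.induce ({v}ᶜ : Set V)).ConnectedComponent

end SimpleGraph

namespace SimpleGraph

/-! Outerplanarity is handled as a noncrossing placement on a line, obtained by cutting the circle
at `v`, so that `v` is the rightmost vertex.

Necessity. In a completion `H`, contracting everything outside a union `S` of branches into `v`
keeps it outerplanar and lengthens no distance. Hence some `y` in `S` is at distance at least ecc*
of `S` from `v` and from every vertex outside `S` (`exists_far_mem_branch`). Each of seven branches
has a neighbour `u` of `v`, and the edge `uv` separates the two sides of `u`. A vertex `x` lies on
one side of the median of these neighbours. Beyond the median there are three more: a path avoiding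
`v` from `x` to the outermost branch passes the first, then the second. The first is adjacent to
`v`, so reaching the second costs at least `dist x v`; the second lies outside the target branch, so
what remains costs at least its ecc*. Thus `dist v x + e ≤ D` for every `x` (`edist_add_le`); take
`x` far from `v` in the union of the first six branches.

Sufficiency. Optimal completions of that union and of each later branch are glued at `v`; vertices
in different parts are joined through `v` (`exists_completion_of_parts`). -/

/-- A placement `f` of the vertices on a line such that no two edges have interleaving ends. -/
def IsNoncrossing {V : Type*} (G : SimpleGraph V) (f : V → ℝ) : Prop :=
  Function.Injective f ∧ ∀ a b c d, G.Adj a b → G.Adj c d →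
    f a < f c → f c < f b → f b < f d → False

/-! ### Chords of the circle versus interleaving on a line -/

/-- Twice the signed area of the triangle `a b c`. -/
noncomputable def orientedArea (a b c : ℂ) : ℝ :=
  (b.re - a.re) * (c.im - a.im) - (b.im - a.im) * (c.re - a.re)

theorem orientedArea_swap (a b c : ℂ) : orientedArea b a c = -orientedArea a b c := by
  simp only [orientedArea]; ring

theorem orientedArea_rotate (a b c : ℂ) : orientedArea b c a = orientedArea a b c := by
  simp only [orientedArea]; ring

theorem orientedArea_left_self (a b : ℂ) : orientedArea a b a = 0 := by
  simp only [orientedArea]; ring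

theorem orientedArea_right_self (a b : ℂ) : orientedArea a b b = 0 := by
  simp only [orientedArea]; ring

/-- Reduces orientation to cyclic order: for increasing angles within one turn all three sines are
positive. -/
theorem orientedArea_exp (x y z : ℝ) :
    orientedArea (Circle.exp x) (Circle.exp y) (Circle.exp z) =
      4 * (Real.sin ((y - x) / 2) * Real.sin ((z - y) / 2) * Real.sin ((z - x) / 2)) := by
  have hre : ∀ t : ℝ, ((Circle.exp t : Circle) : ℂ).re = Real.cos t := fun t => by
    rw [Circle.coe_exp, Complex.exp_ofReal_mul_I_re]
  have him : ∀ t : ℝ, ((Circle.exp t : Circle) : ℂ).im = Real.sin t := fun t => by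
    rw [Circle.coe_exp, Complex.exp_ofReal_mul_I_im]
  simp only [orientedArea, hre, him]
  rw [Real.cos_sub_cos, Real.cos_sub_cos, Real.sin_sub_sin, Real.sin_sub_sin,
    show (z - y) / 2 = (z + x) / 2 - (y + x) / 2 by ring, Real.sin_sub]
  ring

theorem orientedArea_exp_pos {x y z : ℝ} (hxy : x < y) (hyz : y < z)
    (hzx : z - x < 2 * Real.pi) :
    0 < orientedArea (Circle.exp x) (Circle.exp y) (Circle.exp z) := by
  rw [orientedArea_exp]
  have h1 : 0 < Real.sin ((y - x) / 2) := Real.sin_pos_of_pos_of_lt_pi (by linarith) (by linarith)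
  have h2 : 0 < Real.sin ((z - y) / 2) := Real.sin_pos_of_pos_of_lt_pi (by linarith) (by linarith)
  have h3 : 0 < Real.sin ((z - x) / 2) := Real.sin_pos_of_pos_of_lt_pi (by linarith) (by linarith)
  positivity

/-- Chords with interleaving ends on the circle meet. -/
theorem not_disjoint_openSegment_exp {x y z w : ℝ} (hxz : x < z) (hzy : z < y) (hyw : y < w)
    (hwx : w - x < 2 * Real.pi) :
    ¬ Disjoint (openSegment ℝ (Circle.exp x : ℂ) (Circle.exp y : ℂ))
      (openSegment ℝ (Circle.exp z : ℂ) (Circle.exp w : ℂ)) := by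
  have h1 := orientedArea_exp_pos hxz hzy (by linarith)
  have h2 := orientedArea_exp_pos hxz (hzy.trans hyw) (by linarith)
  have h3 := orientedArea_exp_pos (hxz.trans hzy) hyw (by linarith)
  have h4 := orientedArea_exp_pos hzy hyw (by linarith)
  revert h1 h2 h3 h4
  generalize (Circle.exp x : ℂ) = a
  generalize (Circle.exp y : ℂ) = b
  generalize (Circle.exp z : ℂ) = c
  generalize (Circle.exp w : ℂ) = d
  intro h1 h2 h3 h4
  rw [Set.not_disjoint_iff]
  have hsum : orientedArea a c d + orientedArea c b d =
      orientedArea a c b + orientedArea a b d := by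
    simp only [orientedArea]; ring
  have hS : 0 < orientedArea a c d + orientedArea c b d := by linarith
  set S := orientedArea a c d + orientedArea c b d with hSdef
  -- The crossing point divides each chord in the ratio of the areas that the chord's ends span with
  -- the other chord; `S` is twice the area of the quadrilateral.
  refine ⟨(orientedArea c b d / S) • a + (orientedArea a c d / S) • b,
    ⟨_, _, by positivity, by positivity, ?_, rfl⟩,
    ⟨orientedArea a b d / S, orientedArea a c b / S, by positivity, by positivity, ?_, ?_⟩⟩
  · rw [← add_div, add_comm, ← hSdef, div_self hS.ne']
  · rw [← add_div, add_comm, ← hsum, div_self hS.ne']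
  · have key : ∀ p q r s : ℝ, p = orientedArea c b d → q = orientedArea a c d →
        r = orientedArea a b d → s = orientedArea a c b →
        (r / S) • c + (s / S) • d = (p / S) • a + (q / S) • b := by
      rintro p q r s rfl rfl rfl rfl
      apply Complex.ext
      · simp only [Complex.add_re, Complex.real_smul, Complex.re_ofReal_mul]
        rw [div_mul_eq_mul_div, div_mul_eq_mul_div, div_mul_eq_mul_div, div_mul_eq_mul_div,
          ← add_div, ← add_div]
        congr 1
        simp only [orientedArea]; ring
      · simp only [Complex.add_im, Complex.real_smul, Complex.im_ofReal_mul]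
        rw [div_mul_eq_mul_div, div_mul_eq_mul_div, div_mul_eq_mul_div, div_mul_eq_mul_div,
          ← add_div, ← add_div]
        congr 1
        simp only [orientedArea]; ring
    exact key _ _ _ _ rfl rfl rfl rfl

/-- If two open segments meet, then the ends of one are separated by the line of the other. -/
theorem exists_orientedArea_eq_zero {a b c d : ℂ}
    (h : ¬ Disjoint (openSegment ℝ a b) (openSegment ℝ c d)) :
    ∃ s t : ℝ, 0 < s ∧ 0 < t ∧ s * orientedArea c d a + t * orientedArea c d b = 0 := by
  obtain ⟨q, ⟨s, t, hs, ht, hst, rfl⟩, ⟨s', t', hs', ht', hst', h⟩⟩ := Set.not_disjoint_iff.1 h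
  refine ⟨s, t, hs, ht, ?_⟩
  have hre := congrArg Complex.re h
  have him := congrArg Complex.im h
  simp only [Complex.add_re, Complex.real_smul, Complex.re_ofReal_mul, Complex.add_im,
    Complex.im_ofReal_mul] at hre him
  obtain rfl : s = 1 - t := by linarith
  obtain rfl : s' = 1 - t' := by linarith
  simp only [orientedArea]
  linear_combination (d.im - c.im) * hre - (d.re - c.re) * him

theorem orientedArea_exp_of_lt {z w x : ℝ} (hzw : z < w) (hz : -Real.pi < z) (hw : w ≤ Real.pi)
    (hx : -Real.pi < x) (hx' : x ≤ Real.pi) :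
    (orientedArea (Circle.exp z) (Circle.exp w) (Circle.exp x) = 0 → x = z ∨ x = w) ∧
    (0 < orientedArea (Circle.exp z) (Circle.exp w) (Circle.exp x) → x < z ∨ w < x) ∧
    (orientedArea (Circle.exp z) (Circle.exp w) (Circle.exp x) < 0 → z < x ∧ x < w) := by
  rcases lt_trichotomy x z with h | rfl | h
  · have := orientedArea_exp_pos h hzw (by linarith)
    rw [← orientedArea_rotate] at this
    exact ⟨fun h' => by linarith, fun _ => Or.inl h, fun h' => by linarith⟩
  · rw [orientedArea_left_self]; simp
  · rcases lt_trichotomy x w with h' | rfl | h'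
    · have := orientedArea_exp_pos h h' (by linarith)
      rw [orientedArea_swap, ← orientedArea_rotate] at this
      exact ⟨fun h' => by linarith, fun h' => by linarith, fun _ => ⟨h, h'⟩⟩
    · rw [orientedArea_right_self]; simp
    · have := orientedArea_exp_pos hzw h' (by linarith)
      exact ⟨fun h' => by linarith, fun _ => Or.inr h', fun h' => by linarith⟩

/-- A common point puts `x` and `y` strictly on opposite sides of the chord `zw`, or both on its
line; the line meets the circle only at `z` and `w`, so the chords would then coincide. -/
theorem interleave_of_not_disjoint {x y z w : ℝ} (hxy : x < y) (hzw : z < w)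
    (hx : -Real.pi < x) (hy : y ≤ Real.pi) (hz : -Real.pi < z) (hw : w ≤ Real.pi)
    (hne : ¬ (x = z ∧ y = w))
    (h : ¬ Disjoint (openSegment ℝ (Circle.exp x : ℂ) (Circle.exp y : ℂ))
      (openSegment ℝ (Circle.exp z : ℂ) (Circle.exp w : ℂ))) :
    (x < z ∧ z < y ∧ y < w) ∨ (z < x ∧ x < w ∧ w < y) := by
  obtain ⟨s, t, hs, ht, hst⟩ := exists_orientedArea_eq_zero h
  have hX := orientedArea_exp_of_lt hzw hz hw hx (by linarith)
  have hY := orientedArea_exp_of_lt hzw hz hw (by linarith : -Real.pi < y) hy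
  revert hst hX hY
  generalize orientedArea (Circle.exp z) (Circle.exp w) (Circle.exp x) = A
  generalize orientedArea (Circle.exp z) (Circle.exp w) (Circle.exp y) = B
  intro hst hX hY
  rcases lt_trichotomy A 0 with hA | rfl | hA
  · have hB : 0 < B := by
      by_contra hB
      nlinarith [mul_neg_of_pos_of_neg hs hA, mul_nonneg ht.le (neg_nonneg.2 (not_lt.1 hB))]
    have h1 := hX.2.2 hA
    rcases hY.2.1 hB with h2 | h2
    · linarith
    · exact Or.inr ⟨h1.1, h1.2, h2⟩
  · have hB : B = 0 := by
      rcases mul_eq_zero.1 (by linarith : t * B = 0) with h | h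
      · exact absurd h ht.ne'
      · exact h
    exfalso
    rcases hX.1 rfl with h1 | h1 <;> rcases hY.1 hB with h2 | h2
    · linarith
    · exact hne ⟨h1, h2⟩
    · linarith
    · linarith
  · have hB : B < 0 := by
      by_contra hB
      nlinarith [mul_pos hs hA, mul_nonneg ht.le (not_lt.1 hB)]
    have h1 := hY.2.2 hB
    rcases hX.2.1 hA with h2 | h2
    · exact Or.inl ⟨h2, h1.1, h1.2⟩
    · linarith

/-- The drawing can be cut open at any vertex `v`. -/
theorem IsOuterplanar.exists_isNoncrossing {V : Type*} {G : SimpleGraph V} (h : G.IsOuterplanar)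
    (v : V) : ∃ f : V → ℝ, G.IsNoncrossing f ∧ ∀ x, f x ≤ f v := by
  obtain ⟨p, hp, hG⟩ := h
  -- This rotation moves `v` to angle π, the largest value of `arg`.
  set r : Circle := Circle.exp Real.pi / p v with hr
  have harg : ∀ x, Circle.exp (Complex.arg (r * p x : Circle)) = r * p x := fun x =>
    Circle.exp_arg _
  refine ⟨fun x => Complex.arg (r * p x : Circle), ⟨?_, ?_⟩, ?_⟩
  · intro x y hxy
    exact hp (mul_left_cancel (Circle.injective_arg hxy))
  · intro a b c d hab hcd hac hcb hbd
    have hne : s(a, b) ≠ s(c, d) := by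
      intro he
      rcases Sym2.eq_iff.1 he with ⟨rfl, rfl⟩ | ⟨rfl, rfl⟩
      · exact lt_irrefl _ hac
      · exact lt_irrefl _ (hac.trans (hcb.trans hbd))
    have := not_disjoint_openSegment_exp hac hcb hbd (by
      have := Complex.arg_le_pi (r * p d : Circle)
      have := Complex.neg_pi_lt_arg (r * p a : Circle)
      linarith)
    rw [harg, harg, harg, harg, Set.not_disjoint_iff] at this
    obtain ⟨q, ⟨s, t, hs, ht, hst, h1⟩, ⟨s', t', hs', ht', hst', h2⟩⟩ := this
    refine Set.disjoint_left.1 (hG a b c d hab hcd hne) ⟨s, t, hs, ht, hst, rfl⟩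
      ⟨s', t', hs', ht', hst', ?_⟩
    have h0 : ((r : Circle) : ℂ) ≠ 0 := Circle.coe_ne_zero r
    apply mul_left_cancel₀ h0
    rw [← h1] at h2
    simp only [Circle.coe_mul, Complex.real_smul] at h2 ⊢
    linear_combination h2
  · intro x
    have hv : r * p v = Circle.exp Real.pi := by rw [hr]; exact div_mul_cancel _ _
    simp only [hv]
    rw [Circle.arg_exp (by linarith [Real.pi_pos]) le_rfl]
    exact Complex.arg_le_pi _

/-- Doubling `arctan` squeezes the line monotonically into (-π, π), and the values serve as angles.
-/
theorem IsNoncrossing.isOuterplanar {V : Type*} {G : SimpleGraph V} {f : V → ℝ}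
    (h : G.IsNoncrossing f) : G.IsOuterplanar := by
  obtain ⟨hf, hG⟩ := h
  have hmono : StrictMono fun x : ℝ => 2 * Real.arctan x := fun x y hxy => by
    have := Real.arctan_strictMono hxy
    simp only; linarith
  set g : V → ℝ := fun x => 2 * Real.arctan (f x) with hg
  have hlt : ∀ x y, g x < g y ↔ f x < f y := fun x y => hmono.lt_iff_lt
  have hlo : ∀ x, -Real.pi < g x := fun x => by
    have := Real.neg_pi_div_two_lt_arctan (f x); simp only [hg]; linarith
  have hhi : ∀ x, g x ≤ Real.pi := fun x => by
    have := Real.arctan_lt_pi_div_two (f x); simp only [hg]; linarith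
  have hinj : Function.Injective g := hmono.injective.comp hf
  have key : ∀ a b c d : V, G.Adj a b → G.Adj c d → s(a, b) ≠ s(c, d) → g a < g b → g c < g d →
      Disjoint (openSegment ℝ (Circle.exp (g a) : ℂ) (Circle.exp (g b) : ℂ))
        (openSegment ℝ (Circle.exp (g c) : ℂ) (Circle.exp (g d) : ℂ)) := by
    intro a b c d hab hcd hne h1 h2
    by_contra hcon
    rcases interleave_of_not_disjoint h1 h2 (hlo a) (hhi b) (hlo c) (hhi d) (by
      rintro ⟨h, h'⟩
      exact hne (by rw [hinj h, hinj h'])) hcon with h | h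
    · simp only [hlt] at h
      exact hG a b c d hab hcd h.1 h.2.1 h.2.2
    · simp only [hlt] at h
      exact hG c d a b hcd hab h.1 h.2.1 h.2.2
  refine ⟨fun x => Circle.exp (g x), fun x y hxy => ?_, ?_⟩
  · have := congrArg (fun z : Circle => Complex.arg z) hxy
    simp only [Circle.arg_exp (hlo _) (hhi _)] at this
    exact hinj this
  · intro a b c d hab hcd hne
    rcases lt_or_gt_of_ne (hinj.ne hab.ne) with h1 | h1 <;>
      rcases lt_or_gt_of_ne (hinj.ne hcd.ne) with h2 | h2
    · exact key a b c d hab hcd hne h1 h2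
    · rw [openSegment_symm ℝ (Circle.exp (g c) : ℂ)]
      exact key a b d c hab hcd.symm (by rwa [Sym2.eq_swap (a := d)]) h1 h2
    · rw [openSegment_symm ℝ (Circle.exp (g a) : ℂ)]
      exact key b a c d hab.symm hcd (by rwa [Sym2.eq_swap (a := b)]) h1 h2
    · rw [openSegment_symm ℝ (Circle.exp (g a) : ℂ), openSegment_symm ℝ (Circle.exp (g c) : ℂ)]
      exact key b a d c hab.symm hcd.symm
        (by rwa [Sym2.eq_swap (a := b), Sym2.eq_swap (a := d)]) h1 h2

/-! ### Contraction: distances and noncrossing placements -/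

theorem edist_map_le {W U : Type*} {H : SimpleGraph W} {K : SimpleGraph U} (r : W → U)
    (h : ∀ x y, H.Adj x y → r x = r y ∨ K.Adj (r x) (r y)) (x y : W) :
    K.edist (r x) (r y) ≤ H.edist x y := by
  refine le_iInf fun p => ?_
  induction p with
  | nil => simp
  | @cons a b c hab p ih =>
    refine (K.edist_triangle (v := r b)).trans ?_
    rw [Walk.length_cons, Nat.cast_add, add_comm]
    refine add_le_add ih ?_
    rw [Nat.cast_one, edist_le_one_iff_adj_or_eq]
    exact (h a b hab).symm

/-- The simple graph obtained from `H` by identifying the vertices with the same image. -/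
def contract {W U : Type*} (H : SimpleGraph W) (r : W → U) : SimpleGraph U :=
  fromRel fun a b => ∃ x y, H.Adj x y ∧ r x = a ∧ r y = b

theorem contract_adj {W U : Type*} {H : SimpleGraph W} {r : W → U} {a b : U} :
    (H.contract r).Adj a b ↔ a ≠ b ∧ ∃ x y, H.Adj x y ∧ r x = a ∧ r y = b := by
  rw [contract, fromRel_adj]
  refine and_congr_right fun _ => ⟨?_, Or.inl⟩
  rintro (h | ⟨x, y, h, rfl, rfl⟩)
  · exact h
  · exact ⟨y, x, h.symm, rfl, rfl⟩

theorem edist_contract_le {W U : Type*} {H : SimpleGraph W} (r : W → U) (x y : W) :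
    (H.contract r).edist (r x) (r y) ≤ H.edist x y := by
  refine edist_map_le r (fun x y h => ?_) x y
  by_cases hr : r x = r y
  · exact Or.inl hr
  · exact Or.inr (contract_adj.2 ⟨hr, x, y, h, rfl, rfl⟩)

/-- Contracting a connected set (the fibre of `u`) keeps a noncrossing placement noncrossing. -/
theorem IsNoncrossing.contract {W U : Type*} {H : SimpleGraph W} {f : W → ℝ}
    (hf : H.IsNoncrossing f) (j : U ↪ W) (u : U) (r : W → U) (hrj : ∀ a, r (j a) = a)
    (hr : ∀ x, r x ≠ u → j (r x) = x)
    (hT : ∀ P : W → Prop, (∀ x y, r x = u → r y = u → H.Adj x y → (P x ↔ P y)) →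
      ∀ x, r x = u → (P x ↔ P (j u))) :
    (H.contract r).IsNoncrossing (f ∘ j) := by
  -- An edge of the contraction stays on one side of a chord `cd` avoiding `u`: its preimage in `H`
  -- does not cross, and by `hT`, which expresses connectedness of the fibre of `u`, that fibre lies
  -- on one side.
  have key : ∀ a b c d, (H.contract r).Adj a b → H.Adj (j c) (j d) → c ≠ u → d ≠ u →
      f (j c) < f (j d) → a ≠ c → a ≠ d → b ≠ c → b ≠ d →
      ((f (j c) < f (j a) ∧ f (j a) < f (j d)) ↔ (f (j c) < f (j b) ∧ f (j b) < f (j d))) := by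
    intro a b c d hab hcd hc hd hlt hac had hbc hbd
    obtain ⟨-, x, y, hxy, rfl, rfl⟩ := contract_adj.1 hab
    have hedge : ∀ x y, r x ≠ c → r x ≠ d → r y ≠ c → r y ≠ d → H.Adj x y →
        (f (j c) < f x ∧ f x < f (j d)) → (f (j c) < f y ∧ f y < f (j d)) := by
      intro x y _ _ h3 h4 hadj hx
      have hyc : y ≠ j c := fun h => h3 (by rw [h, hrj])
      have hyd : y ≠ j d := fun h => h4 (by rw [h, hrj])
      constructor
      · by_contra hcon
        exact hf.2 y x (j c) (j d) hadj.symm hcd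
          (lt_of_le_of_ne (not_lt.1 hcon) (hf.1.ne hyc)) hx.1 hx.2
      · by_contra hcon
        exact hf.2 (j c) (j d) x y hcd hadj hx.1 hx.2
          (lt_of_le_of_ne (not_lt.1 hcon) (hf.1.ne hyd.symm))
    have hvert : ∀ x, (f (j c) < f x ∧ f x < f (j d)) ↔
        (f (j c) < f (j (r x)) ∧ f (j (r x)) < f (j d)) := by
      intro x
      by_cases hx : r x = u
      · rw [hx]
        refine hT (fun x => f (j c) < f x ∧ f x < f (j d)) (fun x y hx hy hxy => ?_) x hx
        exact ⟨hedge x y (by rw [hx]; exact hc.symm) (by rw [hx]; exact hd.symm)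
            (by rw [hy]; exact hc.symm) (by rw [hy]; exact hd.symm) hxy,
          hedge y x (by rw [hy]; exact hc.symm) (by rw [hy]; exact hd.symm)
            (by rw [hx]; exact hc.symm) (by rw [hx]; exact hd.symm) hxy.symm⟩
      · rw [hr x hx]
    rw [← hvert, ← hvert]
    exact ⟨hedge x y hac had hbc hbd hxy, hedge y x hbc hbd hac had hxy.symm⟩
  have hlift : ∀ c d, (H.contract r).Adj c d → c ≠ u → d ≠ u → H.Adj (j c) (j d) := by
    intro c d hcd hc hd
    obtain ⟨-, x, y, hxy, rfl, rfl⟩ := contract_adj.1 hcd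
    rwa [hr x hc, hr y hd]
  refine ⟨hf.1.comp j.injective, ?_⟩
  intro a b c d hab hcd hac hcb hbd
  simp only [Function.comp] at hac hcb hbd
  have nac : a ≠ c := fun h => by rw [h] at hac; exact lt_irrefl _ hac
  have ncb : c ≠ b := fun h => by rw [h] at hcb; exact lt_irrefl _ hcb
  have nbd : b ≠ d := fun h => by rw [h] at hbd; exact lt_irrefl _ hbd
  have nad : a ≠ d := fun h => by
    rw [h] at hac; exact lt_irrefl _ (hac.trans (hcb.trans hbd))
  -- Interleaving edges have four distinct ends, so at least one of them avoids `u` and lifts to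
  -- `H`.
  by_cases hcdu : c ≠ u ∧ d ≠ u
  · have := key a b c d hab (hlift c d hcd hcdu.1 hcdu.2) hcdu.1 hcdu.2 (hcb.trans hbd)
      nac nad ncb.symm nbd
    exact absurd (this.2 ⟨hcb, hbd⟩).1 (not_lt.2 hac.le)
  · have hau : a ≠ u := by
      rintro rfl
      exact hcdu ⟨nac.symm, nad.symm⟩
    have hbu : b ≠ u := by
      rintro rfl
      exact hcdu ⟨ncb, nbd.symm⟩
    have := key c d a b hcd (hlift a b hab hau hbu) hau hbu (hac.trans hcb)
      nac.symm ncb nad.symm nbd.symm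
    exact absurd (this.1 ⟨hac, hcb⟩).2 (not_lt.2 hbd.le)

/-! ### Unions of branches and their ecc* -/

/-- `S` contains `v` and is a union of `v` and vertex sets of components of `G - v`. -/
def IsBranchUnion {V : Type*} (G : SimpleGraph V) (v : V) (S : Set V) : Prop :=
  v ∈ S ∧ ∀ x y, G.Adj x y → x ≠ v → y ≠ v → x ∈ S → y ∈ S

theorem IsBranchUnion.induce_connected {V : Type*} {G : SimpleGraph V} (hG : G.Connected) {v : V}
    {S : Set V} (hS : G.IsBranchUnion v S) : (G.induce S).Connected := by
  have key : ∀ (x y : V) (p : G.Walk x y) (hx : x ∈ S), y = v →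
      (G.induce S).Reachable ⟨x, hx⟩ ⟨v, hS.1⟩ := by
    intro x y p
    induction p with
    | nil => rintro hx rfl; exact Reachable.refl _
    | @cons a b c hab p ih =>
      intro ha hc
      by_cases hav : a = v
      · subst hav; exact Reachable.refl _
      · have hb : b ∈ S := by
          by_cases hbv : b = v
          · rw [hbv]; exact hS.1
          · exact hS.2 a b hab hav hbv ha
        have hadj : (G.induce S).Adj ⟨a, ha⟩ ⟨b, hb⟩ := hab
        exact hadj.reachable.trans (ih hb hc)
  rw [connected_iff_exists_forall_reachable]
  exact ⟨⟨v, hS.1⟩, fun x => (key x v (hG x v).some x.2 rfl).symm⟩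

/-- Contracting the complement of a union of branches into `v` turns completions of `G`
into completions of the union. -/
theorem IsOuterplanarCompletion.contract {W U : Type*} {D : ℕ} {G H : SimpleGraph W}
    (hH : IsOuterplanarCompletion D G H) (hG : G.Connected) (j : U ↪ W) (u : U)
    (hS : G.IsBranchUnion (j u) (Set.range j)) :
    ∃ (r : W → U) (K : SimpleGraph U), (∀ a, r (j a) = a) ∧ (∀ x, x ∉ Set.range j → r x = u) ∧
      IsOuterplanarCompletion D (G.comap j) K ∧ ∀ x y, K.edist (r x) (r y) ≤ H.edist x y := by
  classical
  obtain ⟨hGH, hout, hdiam⟩ := hH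
  let r : W → U := fun x => if h : x ∈ Set.range j then h.choose else u
  have hrj : ∀ a, r (j a) = a := fun a => by
    have h : j a ∈ Set.range j := ⟨a, rfl⟩
    simp only [r, dif_pos h]
    exact j.injective h.choose_spec
  have hout' : ∀ x, x ∉ Set.range j → r x = u := fun x hx => dif_neg hx
  have hr : ∀ x, r x ≠ u → j (r x) = x := fun x hx => by
    by_cases h : x ∈ Set.range j
    · obtain ⟨a, rfl⟩ := h
      rw [hrj]
    · exact absurd (hout' x h) hx
  have hru : ∀ x, r x = u ↔ x = j u ∨ x ∉ Set.range j := fun x => by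
    constructor
    · intro h
      by_cases hx : x ∈ Set.range j
      · obtain ⟨a, rfl⟩ := hx
        rw [hrj] at h
        exact Or.inl (by rw [h])
      · exact Or.inr hx
    · rintro (rfl | h)
      · exact hrj u
      · exact hout' x h
  refine ⟨r, H.contract r, hrj, hout', ⟨?_, ?_, ?_⟩, edist_contract_le r⟩
  · intro a b hab
    exact contract_adj.2 ⟨hab.ne, j a, j b, hGH hab, hrj a, hrj b⟩
  · obtain ⟨f, hf, -⟩ := hout.exists_isNoncrossing (j u)
    refine (hf.contract j u r hrj hr ?_).isOuterplanar
    intro P hP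
    -- The fibre is connected: a walk of `G` starting outside the range cannot enter it before
    -- reaching `j u`.
    have key : ∀ (x y : W) (_ : G.Walk x y), y = j u → r x = u → (P x ↔ P (j u)) := by
      intro x y p
      induction p with
      | nil => rintro rfl _; rfl
      | @cons a b c hab p ih =>
        intro hc ha
        by_cases hav : a = j u
        · rw [hav]
        · have hb : r b = u := by
            rw [hru] at ha ⊢
            by_cases hbv : b = j u
            · exact Or.inl hbv
            · exact Or.inr fun hb => (ha.resolve_left hav) (hS.2 b a hab.symm hbv hav hb)
          exact (hP a b ha hb (hGH hab)).trans (ih hc hb)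
    exact fun x hx => key x (j u) (hG x (j u)).some rfl hx
  · refine ediam_le_of_edist_le fun a b => ?_
    rw [← hrj a, ← hrj b]
    exact ((edist_contract_le r _ _).trans edist_le_ediam).trans hdiam

theorem eccStar_le {V : Type*} {D : ℕ} {G H : SimpleGraph V}
    (h : IsOuterplanarCompletion D G H) (u : V) : eccStar D G u ≤ H.eccent u :=
  iInf₂_le H h

/-- Finiteness of `k` excludes the empty infimum `⊤`, and strictness below `k + 1` yields a witness.
-/
theorem exists_eccent_le_of_eccStar_le {V : Type*} {D : ℕ} {G : SimpleGraph V} {u : V} {k : ℕ∞}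
    (hk : k ≠ ⊤) (h : eccStar D G u ≤ k) :
    ∃ H, IsOuterplanarCompletion D G H ∧ H.eccent u ≤ k := by
  have hlt : eccStar D G u < k + 1 :=
    lt_of_le_of_lt h ((ENat.lt_add_one_iff hk).2 le_rfl)
  rw [eccStar] at hlt
  simp only [iInf_lt_iff] at hlt
  obtain ⟨H, hH, hlt⟩ := hlt
  exact ⟨H, hH, (ENat.lt_add_one_iff hk).1 hlt⟩

/-- `ecc*` is monotone under passing to a union of branches. -/
theorem eccStar_comap_le {W U : Type*} {D : ℕ} {G : SimpleGraph W} (hG : G.Connected)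
    (j : U ↪ W) (u : U) (hS : G.IsBranchUnion (j u) (Set.range j)) :
    eccStar D (G.comap j) u ≤ eccStar D G (j u) := by
  refine le_iInf₂ fun H hH => ?_
  obtain ⟨r, K, hrj, -, hK, hd⟩ := hH.contract hG j u hS
  refine (eccStar_le hK u).trans (iSup_le fun a => ?_)
  have := hd (j u) (j a)
  rw [hrj, hrj] at this
  exact this.trans edist_le_eccent

theorem eccStarOn_mono {V : Type*} {D : ℕ} {G : SimpleGraph V} (hG : G.Connected) {v : V}
    {S T : Set V} (hST : S ⊆ T) (hS : G.IsBranchUnion v S) (hT : G.IsBranchUnion v T) :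
    G.eccStarOn D S v hS.1 ≤ G.eccStarOn D T v hT.1 := by
  refine eccStar_comap_le (hT.induce_connected hG) (Set.embeddingOfSubset S T hST) ⟨v, hS.1⟩ ?_
  refine ⟨⟨_, rfl⟩, ?_⟩
  rintro x y hxy hx hy ⟨a, rfl⟩
  have hy' : (y : V) ∈ S := hS.2 a y hxy (fun h => hx (Subtype.ext h))
    (fun h => hy (Subtype.ext h)) a.2
  exact ⟨⟨y, hy'⟩, Subtype.ext rfl⟩

/-! ### Gluing completions at a common vertex -/

/-- The union of graphs on the sets `{v} ∪ idx ⁻¹ {i}`. -/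
def glue {V ι : Type*} (v : V) (idx : V → ι)
    (K : ∀ i, SimpleGraph {x : V | x = v ∨ idx x = i}) : SimpleGraph V where
  Adj x y := ∃ i, ∃ hx, ∃ hy, (K i).Adj ⟨x, hx⟩ ⟨y, hy⟩
  symm := ⟨fun _ _ ⟨i, hx, hy, h⟩ => ⟨i, hy, hx, h.symm⟩⟩
  loopless := ⟨fun _ ⟨i, _, _, h⟩ => (K i).loopless.irrefl _ h⟩

/-- Each part, cut open at `v`, is squeezed into its own interval, with `v` to the right of all of
them. In an interleaving only the last end can be `v`, so both edges belong to the same part. -/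
theorem IsOuterplanar.glue {V : Type*} {n : ℕ} (v : V) (idx : V → Fin n)
    (K : ∀ i, SimpleGraph {x : V | x = v ∨ idx x = i}) (hK : ∀ i, (K i).IsOuterplanar) :
    (glue v idx K).IsOuterplanar := by
  classical
  choose f hf hmax using fun i => (hK i).exists_isNoncrossing ⟨v, Or.inl rfl⟩
  have hpi := Real.pi_lt_four
  -- Since π/2 < 2, the intervals of radius 2 around the multiples of 4 keep the parts apart, and `4
  -- * n` exceeds them all.
  let g : V → ℝ := fun x => if x = v then 4 * n
    else 4 * (idx x : ℕ) + Real.arctan (f (idx x) ⟨x, Or.inr rfl⟩)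
  have hgv : g v = 4 * n := if_pos rfl
  have hg : ∀ i x (hx : x = v ∨ idx x = i), x ≠ v →
      g x = 4 * (i : ℕ) + Real.arctan (f i ⟨x, hx⟩) := by
    rintro i x hx hxv
    obtain rfl := hx.resolve_left hxv
    exact if_neg hxv
  have hlo : ∀ i x (_ : x = v ∨ idx x = i), x ≠ v → 4 * ((i : ℕ) : ℝ) - 2 < g x := by
    intro i x hx hxv
    rw [hg i x hx hxv]
    have := Real.neg_pi_div_two_lt_arctan (f i ⟨x, hx⟩)
    linarith
  have hhi : ∀ i x (_ : x = v ∨ idx x = i), x ≠ v → g x < 4 * ((i : ℕ) : ℝ) + 2 := by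
    intro i x hx hxv
    rw [hg i x hx hxv]
    have := Real.arctan_lt_pi_div_two (f i ⟨x, hx⟩)
    linarith
  have hle : ∀ i k : Fin n, 4 * ((i : ℕ) : ℝ) - 2 < 4 * ((k : ℕ) : ℝ) + 2 → i ≤ k := by
    intro i k h
    have : ((i : ℕ) : ℝ) < ((k : ℕ) : ℝ) + 1 := by linarith
    exact Fin.le_def.2 (Nat.lt_succ_iff.1 (by exact_mod_cast this))
  have hlast : ∀ x, x ≠ v → g x < g v := by
    intro x hxv
    have h1 := hhi _ x (Or.inr rfl) hxv
    have h2 : ((idx x : ℕ) : ℝ) + 1 ≤ n := by exact_mod_cast (idx x).2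
    rw [hgv]; linarith
  have hinj : Function.Injective g := by
    intro x y hxy
    by_cases hx : x = v
    · by_contra hne
      have := hlast y (by rintro rfl; exact hne hx)
      rw [hx] at hxy; linarith
    · by_cases hy : y = v
      · have := hlast x hx
        rw [hy] at hxy; linarith
      · have h1 := hle (idx x) (idx y) (by
          linarith [hlo _ x (Or.inr rfl) hx, hhi _ y (Or.inr rfl) hy])
        have h2 := hle (idx y) (idx x) (by
          linarith [hlo _ y (Or.inr rfl) hy, hhi _ x (Or.inr rfl) hx])
        have hi : idx x = idx y := le_antisymm h1 h2
        rw [hg (idx y) x (Or.inr hi) hx, hg (idx y) y (Or.inr rfl) hy] at hxy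
        have := (hf (idx y)).1 (Real.arctan_injective (add_left_cancel hxy))
        exact congrArg Subtype.val this
  have hmono : ∀ i x y (hx : x = v ∨ idx x = i) (hy : y = v ∨ idx y = i), g x < g y →
      f i ⟨x, hx⟩ < f i ⟨y, hy⟩ := by
    intro i x y hx hy hxy
    have hxv : x ≠ v := by
      rintro rfl
      by_cases hyx : y = x
      · rw [hyx] at hxy; exact lt_irrefl _ hxy
      · linarith [hlast y hyx]
    by_cases hyv : y = v
    · subst hyv
      refine lt_of_le_of_ne (hmax i _) fun h => hxv ?_
      exact congrArg Subtype.val ((hf i).1 h)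
    · rw [hg i x hx hxv, hg i y hy hyv] at hxy
      exact Real.arctan_strictMono.lt_iff_lt.1 (by linarith)
  refine IsNoncrossing.isOuterplanar (f := g) ⟨hinj, ?_⟩
  rintro a b c d ⟨i, ha, hb, hab⟩ ⟨k, hc, hd, hcd⟩ hac hcb hbd
  have hne : ∀ x y, g x < g y → x ≠ v := by
    rintro x y hxy rfl
    by_cases hyx : y = x
    · rw [hyx] at hxy; exact lt_irrefl _ hxy
    · linarith [hlast y hyx]
  have hav := hne a c hac
  have hcv := hne c b hcb
  have hbv := hne b d hbd
  obtain rfl : i = k := le_antisymm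
    (hle _ _ (by linarith [hlo i a ha hav, hhi k c hc hcv]))
    (hle _ _ (by linarith [hlo k c hc hcv, hhi i b hb hbv]))
  exact (hf i).2 _ _ _ _ hab hcd (hmono i a c ha hc hac) (hmono i c b hc hb hcb)
    (hmono i b d hb hd hbd)

/-- Completions of parts sharing only `v` can be glued at `v`, provided that the eccentricities
of `v` in two different parts add up to at most `D`. -/
theorem exists_completion_of_parts {V : Type*} {n D : ℕ} {G : SimpleGraph V} {v : V}
    (idx : V → Fin n) (hidx : ∀ x y, G.Adj x y → x ≠ v → y ≠ v → idx x = idx y)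
    (e : Fin n → ℕ∞) (he : ∀ i k, i ≠ k → e i + e k ≤ D) (htop : ∀ i, e i ≠ ⊤)
    (hecc : ∀ i, G.eccStarOn D {x : V | x = v ∨ idx x = i} v (Or.inl rfl) ≤ e i) :
    ∃ H, G.IsOuterplanarCompletion D H := by
  choose K hK hKe using fun i => exists_eccent_le_of_eccStar_le (htop i) (hecc i)
  have hd : ∀ i (x y : {x : V | x = v ∨ idx x = i}),
      (glue v idx K).edist x.1 y.1 ≤ (K i).edist x y := fun i x y =>
    edist_map_le (K := glue v idx K) Subtype.val (fun x y hxy => Or.inr ⟨i, x.2, y.2, hxy⟩) x y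
  refine ⟨glue v idx K, ?_, IsOuterplanar.glue v idx K fun i => (hK i).2.1, ?_⟩
  · intro x y hxy
    have : ∃ i, ∃ (_ : x = v ∨ idx x = i), (y = v ∨ idx y = i) := by
      by_cases hx : x = v
      · exact ⟨idx y, Or.inl hx, Or.inr rfl⟩
      · by_cases hy : y = v
        · exact ⟨idx x, Or.inr rfl, Or.inl hy⟩
        · exact ⟨idx y, Or.inr (hidx x y hxy hx hy), Or.inr rfl⟩
    obtain ⟨i, hx, hy⟩ := this
    exact ⟨i, hx, hy, (hK i).1 (show G.Adj x y from hxy)⟩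
  · refine ediam_le_of_edist_le fun x y => ?_
    by_cases hxy : idx x = idx y
    · exact (hd (idx y) ⟨x, Or.inr hxy⟩ ⟨y, Or.inr rfl⟩).trans
        (edist_le_ediam.trans (hK (idx y)).2.2)
    · refine (SimpleGraph.edist_triangle (v := v)).trans (le_trans (add_le_add ?_ ?_) (he _ _ hxy))
      · rw [edist_comm]
        exact (hd (idx x) ⟨v, Or.inl rfl⟩ ⟨x, Or.inr rfl⟩).trans (edist_le_eccent.trans (hKe _))
      · exact (hd (idx y) ⟨v, Or.inl rfl⟩ ⟨y, Or.inr rfl⟩).trans (edist_le_eccent.trans (hKe _))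

/-! ### Separation by edges at `v` and the seven-branch bound -/

theorem mem_branch_iff {V : Type*} {G : SimpleGraph V} {v x : V} (hx : x ≠ v)
    {C : (G.induce ({v}ᶜ : Set V)).ConnectedComponent} :
    x ∈ G.branch v C ↔ (G.induce ({v}ᶜ : Set V)).connectedComponentMk ⟨x, hx⟩ = C := by
  constructor
  · rintro (h | ⟨y, hy, rfl⟩)
    · exact absurd h hx
    · exact hy
  · intro h
    exact Or.inr ⟨⟨x, hx⟩, h, rfl⟩

theorem isBranchUnion_branch {V : Type*} (G : SimpleGraph V) (v : V)
    (C : (G.induce ({v}ᶜ : Set V)).ConnectedComponent) : G.IsBranchUnion v (G.branch v C) := by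
  refine ⟨G.mem_branch v C, fun x y hxy hx hy hxC => ?_⟩
  rw [mem_branch_iff hx] at hxC
  rw [mem_branch_iff hy, ← hxC]
  refine ConnectedComponent.sound (Adj.reachable ?_)
  exact hxy.symm

theorem IsBranchUnion.iUnion {V ι : Type*} [Nonempty ι] {G : SimpleGraph V} {v : V}
    {S : ι → Set V} (hS : ∀ i, G.IsBranchUnion v (S i)) : G.IsBranchUnion v (⋃ i, S i) := by
  refine ⟨Set.mem_iUnion_of_mem (Classical.arbitrary ι) (hS _).1, fun x y hxy hx hy hxS => ?_⟩
  obtain ⟨i, hi⟩ := Set.mem_iUnion.1 hxS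
  exact Set.mem_iUnion_of_mem i ((hS i).2 x y hxy hx hy hi)

theorem exists_mem_branch_adj {V : Type*} {G : SimpleGraph V} (hG : G.Connected) (v : V)
    (C : (G.induce ({v}ᶜ : Set V)).ConnectedComponent) :
    ∃ u, u ≠ v ∧ u ∈ G.branch v C ∧ G.Adj u v := by
  have key : ∀ (x y : V) (_ : G.Walk x y), y = v → x ≠ v → x ∈ G.branch v C →
      ∃ u, u ≠ v ∧ u ∈ G.branch v C ∧ G.Adj u v := by
    intro x y p
    induction p with
    | nil => exact fun h h' => absurd h h'
    | @cons a b c hab p ih =>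
      intro hc ha haC
      by_cases hb : b = v
      · exact ⟨a, ha, haC, hb ▸ hab⟩
      · exact ih hc hb ((isBranchUnion_branch G v C).2 a b hab ha hb haC)
  obtain ⟨x, rfl⟩ := C.exists_rep
  exact key x v (hG x v).some rfl x.2 ((mem_branch_iff x.2).2 rfl)

/-- An edge `uv` with `v` outermost separates the vertices on the two sides of `u`. -/
theorem IsNoncrossing.mem_support {V : Type*} {H : SimpleGraph V} {f : V → ℝ}
    (hf : H.IsNoncrossing f) {u v : V} (hmax : ∀ x, f x ≤ f v) (huv : H.Adj u v) {x y : V}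
    (p : H.Walk x y) (hx : f x ≤ f u) (hy : f u ≤ f y) : u ∈ p.support ∨ v ∈ p.support := by
  induction p with
  | nil =>
    left
    rw [hf.1 (le_antisymm hx hy)]
    exact Walk.start_mem_support _
  | @cons a b c hab p ih =>
    by_cases hau : a = u
    · left; rw [← hau]; exact Walk.start_mem_support _
    · by_cases hb : f b ≤ f u
      · rw [Walk.support_cons]
        exact (ih hb hy).imp (List.mem_cons_of_mem _) (List.mem_cons_of_mem _)
      · by_cases hbv : b = v
        · right
          rw [Walk.support_cons, ← hbv]
          exact List.mem_cons_of_mem _ (Walk.start_mem_support _)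
        · exact (hf.2 a b u v hab huv (lt_of_le_of_ne hx (hf.1.ne hau)) (not_le.1 hb)
            (lt_of_le_of_ne (hmax b) (hf.1.ne hbv))).elim

theorem exists_walk_of_mem_branch {V : Type*} {G H : SimpleGraph V} (hGH : G ≤ H) {v x y : V}
    {C : (G.induce ({v}ᶜ : Set V)).ConnectedComponent} (hx : x ≠ v) (hy : y ≠ v)
    (hxC : x ∈ G.branch v C) (hyC : y ∈ G.branch v C) :
    ∃ p : H.Walk x y, ∀ z ∈ p.support, z ≠ v ∧ z ∈ G.branch v C := by
  classical
  rw [mem_branch_iff hx] at hxC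
  rw [mem_branch_iff hy, ← hxC] at hyC
  obtain ⟨q⟩ := ConnectedComponent.exact hyC.symm
  let φ : G.induce ({v}ᶜ : Set V) →g H := ⟨Subtype.val, fun h => hGH h⟩
  refine ⟨q.map φ, fun z hz => ?_⟩
  rw [Walk.support_map, List.mem_map] at hz
  obtain ⟨w, hw, rfl⟩ := hz
  refine ⟨w.2, (mem_branch_iff w.2).2 ?_⟩
  rw [← hxC]
  exact ConnectedComponent.sound ⟨(q.takeUntil w hw).reverse⟩

/-- If every walk from `x` to `y` avoiding `v` meets first the neighbour `w₁` of `v` and then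
another vertex `w₂`, then the detour through `v` is no longer than a shortest walk. -/
theorem exists_edist_add_edist_le {V : Type*} {H : SimpleGraph V} {v w₁ w₂ x y : V}
    (hadj : H.Adj w₁ v) (hne : w₁ ≠ w₂)
    (h₂ : ∀ p : H.Walk x y, w₂ ∈ p.support ∨ v ∈ p.support)
    (h₁ : ∀ p : H.Walk x w₂, w₁ ∈ p.support ∨ v ∈ p.support) :
    ∃ w, (w = v ∨ w = w₂) ∧ H.edist x v + H.edist w y ≤ H.edist x y := by
  classical
  by_cases htop : H.edist x y = ⊤
  · exact ⟨v, Or.inl rfl, by rw [htop]; exact le_top⟩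
  obtain ⟨p, hp⟩ := exists_walk_of_edist_ne_top htop
  have split : ∀ w (hw : w ∈ p.support),
      ((p.takeUntil w hw).length : ℕ∞) + (p.dropUntil w hw).length = H.edist x y := by
    intro w hw
    rw [← hp, ← Nat.cast_add, ← Walk.length_append, Walk.take_spec]
  by_cases hv : v ∈ p.support
  · refine ⟨v, Or.inl rfl, ?_⟩
    rw [← split v hv]
    exact add_le_add (edist_le _) (edist_le _)
  · have hw₂ := (h₂ p).resolve_right hv
    refine ⟨w₂, Or.inr rfl, ?_⟩
    rw [← split w₂ hw₂]
    refine add_le_add ?_ (edist_le _)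
    set q := p.takeUntil w₂ hw₂ with hq
    have hw₁ := (h₁ q).resolve_right fun h => hv (p.support_takeUntil_subset_support hw₂ h)
    have hlen : q.length = (q.takeUntil w₁ hw₁).length + (q.dropUntil w₁ hw₁).length := by
      rw [← Walk.length_append, Walk.take_spec]
    -- The nonempty stretch from `w₁` to `w₂` pays for the edge from `w₁` to `v`.
    have hpos : 1 ≤ (q.dropUntil w₁ hw₁).length := by
      by_contra hcon
      exact hne (Walk.eq_of_length_eq_zero (p := q.dropUntil w₁ hw₁) (by omega))
    refine (SimpleGraph.edist_triangle (v := w₁)).trans ?_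
    rw [hlen, Nat.cast_add]
    refine add_le_add (edist_le _) ?_
    rw [edist_eq_one_iff_adj.2 hadj]
    exact_mod_cast hpos

/-- Some vertex of the branch has distance at least `ecc*` from all vertices outside. -/
theorem IsOuterplanarCompletion.exists_far_mem_branch {V : Type*} [Finite V] {D : ℕ}
    {G H : SimpleGraph V} (hH : G.IsOuterplanarCompletion D H) (hG : G.Connected) {v : V}
    {S : Set V} (hS : G.IsBranchUnion v S) :
    ∃ y ∈ S, ∀ w, w = v ∨ w ∉ S → G.eccStarOn D S v hS.1 ≤ H.edist w y := by
  obtain ⟨r, K, hrj, hout, hK, hd⟩ := hH.contract hG (Function.Embedding.subtype (· ∈ S))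
    ⟨v, hS.1⟩ (by simpa using hS)
  obtain ⟨y, hy⟩ := K.exists_edist_eq_eccent_of_finite (⟨v, hS.1⟩ : S)
  refine ⟨y, y.2, fun w hw => ?_⟩
  -- All admissible `w` contract to `v`, so a single `y` serves them all.
  have hrw : r w = ⟨v, hS.1⟩ := by
    by_cases hwS : w ∈ S
    · obtain rfl := hw.resolve_right (not_not.2 hwS)
      exact hrj ⟨w, hwS⟩
    · exact hout w (by simpa using hwS)
  have h := hd w y
  rw [hrw, show r y = y from hrj y, hy] at h
  exact (eccStar_le hK _).trans h

theorem eccStarOn_congr {V : Type*} {D : ℕ} {G : SimpleGraph V} {v : V} {S T : Set V}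
    (h : S = T) (hS : v ∈ S) (hT : v ∈ T) : G.eccStarOn D S v hS = G.eccStarOn D T v hT := by
  subst h; rfl

/-- In a completion of a graph with seven branches at `v` whose `ecc*` is at least `e`, all
vertices have distance at most `D - e` from `v`. -/
theorem IsOuterplanarCompletion.edist_add_le {V : Type*} [Finite V] {D : ℕ} {G H : SimpleGraph V}
    (hH : G.IsOuterplanarCompletion D H) (hG : G.Connected) {v : V}
    (C : Fin 7 → (G.induce ({v}ᶜ : Set V)).ConnectedComponent) (hC : Function.Injective C)
    {e : ℕ∞} (he : ∀ l, e ≤ G.eccStarOn D (G.branch v (C l)) v (G.mem_branch v (C l))) (x : V) :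
    H.edist v x + e ≤ D := by
  obtain ⟨f, hf, hmax⟩ := hH.2.1.exists_isNoncrossing v
  choose u huv huC hadj using fun l => exists_mem_branch_adj hG v (C l)
  have hdisj : ∀ l m z, z ≠ v → z ∈ G.branch v (C l) → z ∈ G.branch v (C m) → l = m := by
    intro l m z hz h1 h2
    rw [mem_branch_iff hz] at h1 h2
    exact hC (h1.symm.trans h2)
  have huinj : Function.Injective u := fun l m h =>
    hdisj l m (u l) (huv l) (huC l) (by rw [h]; exact huC m)
  set σ := Tuple.sort (f ∘ u) with hσ
  have hmono : StrictMono ((f ∘ u) ∘ σ) := (Tuple.monotone_sort (f ∘ u)).strictMono_of_injective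
    ((hf.1.comp huinj).comp σ.injective)
  -- Branch `l` without `v` is connected and misses `u m`, so it lies on one side of `u m`.
  have hside : ∀ l m z, l ≠ m → z ≠ v → z ∈ G.branch v (C l) →
      (f (u m) < f (u l) → f (u m) ≤ f z) ∧ (f (u l) < f (u m) → f z ≤ f (u m)) := by
    intro l m z hlm hz hzC
    obtain ⟨p, hp⟩ := exists_walk_of_mem_branch hH.1 (huv l) hz (huC l) hzC
    have h1 : u m ∉ p.support := fun h =>
      hlm (hdisj l m (u m) (huv m) (hp _ h).2 (huC m))
    have h2 : v ∉ p.support := fun h => (hp _ h).1 rfl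
    constructor
    · intro hlt
      by_contra hcon
      rcases hf.mem_support hmax (hH.1 (hadj m)) p.reverse (not_le.1 hcon).le hlt.le with h | h
      · exact h1 (by simpa using h)
      · exact h2 (by simpa using h)
    · intro hlt
      by_contra hcon
      exact (hf.mem_support hmax (hH.1 (hadj m)) p hlt.le (not_le.1 hcon).le).elim h1 h2
  -- Here `l` is the target branch, and `u m₁`, `u m₂` are the separators in the order met from `x`.
  have main : ∀ l m₁ m₂, m₁ ≠ m₂ → l ≠ m₂ →
      (∀ y, y ≠ v → y ∈ G.branch v (C l) →
        ∀ p : H.Walk x y, u m₂ ∈ p.support ∨ v ∈ p.support) →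
      (∀ p : H.Walk x (u m₂), u m₁ ∈ p.support ∨ v ∈ p.support) → H.edist v x + e ≤ D := by
    intro l m₁ m₂ h12 hl2 h₂ h₁
    obtain ⟨y, hyC, hy⟩ := hH.exists_far_mem_branch hG (isBranchUnion_branch G v (C l))
    have h₂' : ∀ p : H.Walk x y, u m₂ ∈ p.support ∨ v ∈ p.support := by
      by_cases hyv : y = v
      · subst hyv
        exact fun p => Or.inr p.end_mem_support
      · exact h₂ y hyv hyC
    obtain ⟨w, hw, hle⟩ := exists_edist_add_edist_le (hH.1 (hadj m₁)) (huinj.ne h12) h₂' h₁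
    rw [H.edist_comm (u := v)]
    refine le_trans (add_le_add le_rfl ?_) (hle.trans (edist_le_ediam.trans hH.2.2))
    refine (he l).trans (hy w (hw.imp_right ?_))
    rintro rfl h
    exact hl2 (hdisj l m₂ _ (huv m₂) h (huC m₂))
  have hlt : ∀ i k : Fin 7, i < k → f (u (σ i)) < f (u (σ k)) := fun i k h => hmono h
  have hneσ : ∀ i k : Fin 7, i ≠ k → σ i ≠ σ k := fun i k h => σ.injective.ne h
  -- Position 3 is the median of seven, leaving two separators and a target on either side.
  rcases le_total (f x) (f (u (σ 3))) with hx | hx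
  · refine main (σ 6) (σ 4) (σ 5) (hneσ _ _ (by decide)) (hneσ _ _ (by decide)) ?_ ?_
    · intro y hyv hy p
      exact hf.mem_support hmax (hH.1 (hadj _)) p (hx.trans (hlt 3 5 (by decide)).le)
        ((hside (σ 6) (σ 5) y (hneσ _ _ (by decide)) hyv hy).1 (hlt 5 6 (by decide)))
    · intro p
      exact hf.mem_support hmax (hH.1 (hadj _)) p (hx.trans (hlt 3 4 (by decide)).le)
        (hlt 4 5 (by decide)).le
  · refine main (σ 0) (σ 2) (σ 1) (hneσ _ _ (by decide)) (hneσ _ _ (by decide)) ?_ ?_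
    · intro y hyv hy p
      have := hf.mem_support hmax (hH.1 (hadj (σ 1))) p.reverse
        ((hside (σ 0) (σ 1) y (hneσ _ _ (by decide)) hyv hy).2 (hlt 0 1 (by decide)))
        ((hlt 1 3 (by decide)).le.trans hx)
      simpa using this
    · intro p
      have := hf.mem_support hmax (hH.1 (hadj (σ 2))) p.reverse
        (hlt 1 2 (by decide)).le ((hlt 2 3 (by decide)).le.trans hx)
      simpa using this

end SimpleGraph

/-! ### The equivalence -/

theorem mainTheorem3 {V : Type*} [Finite V] (G : SimpleGraph V)
    (hconn : G.Connected) (houter : G.IsOuterplanar)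
    (v : V) (hv : G.IsCutVertex v) (D t : ℕ) (ht : 7 ≤ t)
    (C : Fin t ≃ (G.induce ({v}ᶜ : Set V)).ConnectedComponent)
    (hord : ∀ i j : Fin t, i ≤ j →
      G.eccStarOn D (G.branch v (C j)) v (G.mem_branch v (C j)) ≤
        G.eccStarOn D (G.branch v (C i)) v (G.mem_branch v (C i))) :
    (∃ H : SimpleGraph V, G.IsOuterplanarCompletion D H) ↔
      G.eccStarOn D (⋃ i : Fin 6, G.branch v (C (i.castLE (by omega)))) v
          (Set.mem_iUnion_of_mem 0 (G.mem_branch v _)) +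
        G.eccStarOn D (G.branch v (C ⟨6, by omega⟩)) v (G.mem_branch v _) ≤ (D : ℕ∞) := by
  have hS : G.IsBranchUnion v (⋃ i : Fin 6, G.branch v (C (i.castLE (by omega)))) :=
    SimpleGraph.IsBranchUnion.iUnion fun i => SimpleGraph.isBranchUnion_branch G v _
  constructor
  · rintro ⟨H, hH⟩
    obtain ⟨y, -, hy⟩ := hH.exists_far_mem_branch hconn hS
    refine le_trans (add_le_add (hy v (Or.inl rfl)) le_rfl) ?_
    refine hH.edist_add_le hconn (fun l : Fin 7 => C (l.castLE ht))
      (C.injective.comp (Fin.castLE_injective ht)) (fun l => hord _ _ ?_) y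
    exact Fin.le_def.2 (Nat.lt_succ_iff.1 l.2)
  · intro hle
    obtain ⟨m, rfl⟩ : ∃ m, t = m + 7 := ⟨t - 7, by omega⟩
    classical
    set S := ⋃ i : Fin 6, G.branch v (C (i.castLE (by omega))) with hSdef
    set e₀ := G.eccStarOn D S v hS.1 with he₀
    set e₆ := G.eccStarOn D (G.branch v (C ⟨6, by omega⟩)) v (G.mem_branch v _) with he₆
    -- The seventh branch is bounded by the first, hence by the union; this covers pairs of parts
    -- not involving the union.
    have h60 : e₆ ≤ e₀ := (hord 0 _ (Fin.zero_le _)).trans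
      (SimpleGraph.eccStarOn_mono hconn (Set.subset_iUnion (fun i : Fin 6 =>
        G.branch v (C (i.castLE (by omega)))) 0) (SimpleGraph.isBranchUnion_branch G v _) hS)
    have hsum : e₀ + e₆ ≠ ⊤ := ne_top_of_le_ne_top (ENat.natCast_ne_top D) hle
    have h0 : e₀ ≠ ⊤ := ne_top_of_le_ne_top hsum le_self_add
    have h6 : e₆ ≠ ⊤ := ne_top_of_le_ne_top h0 h60
    let comp : V → Fin (m + 7) := fun x => if hx : x = v then 0 else
      C.symm ((G.induce ({v}ᶜ : Set V)).connectedComponentMk ⟨x, hx⟩)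
    have hcomp : ∀ x, x ≠ v → ∀ i, x ∈ G.branch v (C i) ↔ comp x = i := fun x hx i => by
      rw [SimpleGraph.mem_branch_iff hx, show comp x = _ from dif_neg hx, Equiv.symm_apply_eq]
    -- Truncated subtraction merges the branches indexed 0 to 5 into part 0 and gives every later
    -- branch its own part.
    let idx : V → Fin (m + 2) := fun x => ⟨(comp x : ℕ) - 5, by omega⟩
    have hzero : ∀ i : Fin (m + 2), i = 0 → {x : V | x = v ∨ idx x = i} = S := by
      rintro i rfl
      ext x
      rw [hSdef, Set.mem_iUnion, Set.mem_ofPred_eq]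
      by_cases hx : x = v
      · subst hx
        exact ⟨fun _ => ⟨0, G.mem_branch x _⟩, fun _ => Or.inl rfl⟩
      · simp only [hcomp x hx, hx, false_or, idx, Fin.ext_iff, Fin.val_zero, Fin.val_castLE]
        constructor
        · intro h
          exact ⟨⟨comp x, by omega⟩, rfl⟩
        · rintro ⟨i, hi⟩
          omega
    have hpos : ∀ i : Fin (m + 2), i ≠ 0 →
        {x : V | x = v ∨ idx x = i} = G.branch v (C ⟨i + 5, by omega⟩) := by
      intro i hi
      have hi' : (i : ℕ) ≠ 0 := fun h => hi (Fin.ext h)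
      ext x
      rw [Set.mem_ofPred_eq]
      by_cases hx : x = v
      · subst hx
        exact ⟨fun _ => G.mem_branch x _, fun _ => Or.inl rfl⟩
      · simp only [hcomp x hx, hx, false_or, idx, Fin.ext_iff]
        omega
    refine SimpleGraph.exists_completion_of_parts (v := v) idx ?_ (fun i => if i = 0 then e₀ else e₆) ?_ ?_ ?_
    · intro x y hxy hx hy
      have h := (SimpleGraph.isBranchUnion_branch G v (C (comp x))).2 x y hxy hx hy ((hcomp x hx _).2 rfl)
      simp only [idx, (hcomp y hy _).1 h]
    · intro i k hik
      by_cases hi : i = 0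
      · rw [if_pos hi, if_neg (fun h => hik (hi.trans h.symm))]
        exact hle
      · rw [if_neg hi]
        refine le_trans ?_ hle
        rw [add_comm e₀]
        refine add_le_add le_rfl ?_
        split_ifs
        · exact le_rfl
        · exact h60
    · intro i
      split_ifs
      · exact h0
      · exact h6
    · intro i
      by_cases hi : i = 0
      · rw [if_pos hi, SimpleGraph.eccStarOn_congr (hzero i hi) _ hS.1]
      · rw [if_neg hi, SimpleGraph.eccStarOn_congr (hpos i hi) _ (G.mem_branch v _)]
        refine hord _ _ (Fin.le_def.2 ?_)
        have hi' : (i : ℕ) ≠ 0 := fun h => hi (Fin.ext h)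
        simp only
        omega
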